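/- **Setting.** There are $N$ agents. Agent $i$ has a finite set $\mathcal S^i$ of local states, an initial state $s_I^i$, a finite set $\mathcal A^i$ of local actions and transition probabilities $\mathcal T^i(s^i,a^i,\cdot)$ on $\mathcal S^i$. Put $\boldsymbol{\mathcal S}=\prod_i\mathcal S^i$, $\boldsymbol{\mathcal A}=\prod_i\mathcal A^i$, $\boldsymbol s_I=(s_I^i)_i$ and $\boldsymbol{\mathcal T}(\boldsymbol s,\boldsymbol a,\boldsymbol y)=\prod_i\mathcal T^i(s^i,a^i,y^i)$. Let $\pi$ be a stationary joint policy, i.e. $\pi(\boldsymbol s)$ is a probability distribution on $\boldsymbol{\mathcal A}$ for each $\boldsymbol s\in\boldsymbol{\mathcal S}$. A joint path is an infinite sequence $\boldsymbol s_0\boldsymbol a_0\boldsymbol s_1\boldsymbol a_1\ldots$. **Full communication.** $\Gamma^{full}$ is the law of the joint path with $\boldsymbol s_0=\boldsymbol s_I$, $\boldsymbol a_t\sim\pi(\boldsymbol s_t)$ and $\boldsymbol s_{t+1}\sim\boldsymbol{\mathcal T}(\boldsymbol s_t,\boldsymbol a_t)$. **Imaginary play.** Let $f:(\boldsymbol{\mathcal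 S}\times\boldsymbol{\mathcal A})^*\to\{0,1\}$ be an arbitrary function. Communication is available at time $t$ iff $f(\boldsymbol s_0\boldsymbol a_0\ldots\boldsymbol s_{t-1}\boldsymbol a_{t-1})=1$, where the argument is the true joint history (the empty word $\varepsilon$ if $t=0$). Let $t_{loss}\in\{0,1,\ldots\}\cup\{\infty\}$ be the first time at which communication is not available. At the times $t<t_{loss}$ the agents share the true joint state $\boldsymbol s_t$ and one joint action $\boldsymbol a_t\sim\pi(\boldsymbol s_t)$. From time $t_{loss}$ on they never communicate again. At each time $t\ge t_{loss}$, every agent $i$, independently of the other agents, keeps its own version $\hat{\boldsymbol s}_{t,i}$ of the joint state, whose $i$-th component is its true local state $s^i_t$ and whose other components are imaginary copies of its teammates' states. This version is $\boldsymbol s_I$ if $t=0$ and otherwise is drawn from $\boldsymbol{\mathcal T}(\hat{\boldsymbol s}_{t-1,i},\hat{\boldsymbol a}_{t-1,i})$, where $\hat{\boldsymbol s}_{t-1,i}=\boldsymbol s_{t-1}$ and $\hat{\boldsymbol a}_{t-1,i}=\boldsymbol a_{t-1}$ when $t=t_{loss}$. Agent $i$ then draws its own joint action $\hat{\boldsymbol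 a}_{t,i}\sim\pi(\hat{\boldsymbol s}_{t,i})$ and executes only the $i$-th component, $a^i_t=\hat a^i_{t,i}$. Let $\Gamma^{img}_f$ be the law of the resulting true joint path $((s^i_t)_i,(a^i_t)_i)_{t\ge0}$, and let $\Gamma^{img}_0$ be this law when communication is never available ($f\equiv0$, $t_{loss}=0$). **Total correlation.** For $X=(X^1,\ldots,X^N)$ distributed as $\Gamma^{full}$, with $X^i$ the state-action path of agent $i$, let $C_\pi\in[0,\infty]$ be the total correlation of $X^1,\ldots,X^N$, i.e. the Kullback–Leibler divergence $KL$ of the law of $X$ from the product of the laws of the $X^i$. Let $H$ be the Shannon entropy, with $H=\infty$ for non-discrete laws. **Lemma.** For every $f$, $$KL(\Gamma^{full}\,\|\,\Gamma^{img}_f)\;\le\;KL(\Gamma^{full}\,\|\,\Gamma^{img}_0)\qquad\text{in }[0,\infty],$$ and $KL(\Gamma^{full}\,\|\,\Gamma^{img}_0)=C_\pi$; moreover, if $H(X)<\infty$, then $C_\pi=\sum_{i=1}^N H(X^i)-H(X)$. -/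

import Mathlib

open MeasureTheory ProbabilityTheory InformationTheory
open scoped ENNReal

namespace ImaginaryPlay

noncomputable section

/-- The law of independent draws, one from each `p i`:
it gives the tuple `y` the probability `∏ i, p i (y i)`. -/
def piPMF {ι : Type*} [Fintype ι] {X : ι → Type*} [∀ i, Fintype (X i)]
    (p : ∀ i, PMF (X i)) : PMF (∀ i, X i) :=
  haveI : DecidableEq ι := Classical.decEq ι
  PMF.ofFintype (fun y => ∏ i, p i (y i)) (by
    rw [← Fintype.prod_sum]
    refine Finset.prod_eq_one fun i _ => ?_
    rw [← tsum_fintype (L := .unconditional _)]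
    exact (p i).tsum_coe)

/-- The kernel that sends `x₀, …, xₙ` to the law `next [x₀, …, xₙ]` of the next letter. -/
def nextKernel {X : Type*} [Finite X] [MeasurableSpace X] [MeasurableSingletonClass X]
    (next : List X → PMF X) (n : ℕ) : Kernel (Finset.Iic n → X) X :=
  Kernel.ofFunOfCountable fun h : (Finset.Iic n → X) =>
    (next (List.ofFn fun k : Fin (n + 1) =>
      h ⟨k, Finset.mem_Iic.2 (Nat.le_of_lt_succ k.isLt)⟩)).toMeasure

instance instMarkovNextKernel {X : Type*} [Finite X] [MeasurableSpace X]
    [MeasurableSingletonClass X] (next : List X → PMF X) (n : ℕ) :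
    IsMarkovKernel (nextKernel next n) :=
  ⟨fun _ => PMF.toMeasure.isProbabilityMeasure _⟩

/-- The law on infinite sequences `x₀ x₁ x₂ …` of the process in which, for every `n`, the
letter `xₙ` is drawn from `next [x₀, …, xₙ₋₁]`, given the letters before it. -/
def processLaw {X : Type*} [Finite X] [MeasurableSpace X] [MeasurableSingletonClass X]
    (next : List X → PMF X) : Measure (ℕ → X) :=
  Kernel.trajMeasure (X := fun _ => X) (next []).toMeasure (nextKernel next)

/-- Shannon entropy (natural logarithm), in `[0, ∞]`, of a random variable with law `μ`:
`-∑ x, μ {x} log (μ {x})` if the law is discrete, that is, carried by a countable set,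
and `∞` otherwise. -/
def entropy {X : Type*} [MeasurableSpace X] (μ : Measure X) : ℝ≥0∞ :=
  open Classical in
  if ∃ s : Set X, s.Countable ∧ μ sᶜ = 0 then
    ∑' x, ENNReal.ofReal (Real.negMulLog (μ.real {x}))
  else ⊤

/-- A cooperative Markov game: agent `i` has the local states `S i`, the local actions `A i`, the
initial local state `init i` and the local transition function `trans i`. -/
structure Game (ι : Type*) (S A : ι → Type*) where
  init : ∀ i, S i
  trans : ∀ i, S i → A i → PMF (S i)

/-- A joint state together with a joint action. -/
abbrev Joint {ι : Type*} (S A : ι → Type*) : Type _ := (∀ i, S i) × (∀ i, A i)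

/-- A (stationary) joint policy. -/
abbrev Policy {ι : Type*} (S A : ι → Type*) : Type _ := (∀ i, S i) → PMF (∀ i, A i)

section Execution

variable {ι : Type*} [Fintype ι] {S A : ι → Type*}
  [∀ i, Fintype (S i)] [∀ i, Fintype (A i)]

/-- The joint transition function; the dynamics of the agents are independent. -/
def Game.jointTrans (G : Game ι S A) (s : ∀ i, S i) (a : ∀ i, A i) : PMF (∀ i, S i) :=
  piPMF fun i => G.trans i (s i) (a i)

/-- The law of the next pair of joint state and joint action when the whole team is played by one
player: the joint state is initial if there is no previous pair, and otherwise follows the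
joint transition function; the joint action is drawn from the joint policy at that state. -/
def Game.nextJoint (G : Game ι S A) (π : Policy S A) (prev : Option (Joint S A)) :
    PMF (Joint S A) :=
  (match prev with
    | none => PMF.pure G.init
    | some x => G.jointTrans x.1 x.2).bind fun s => (π s).map fun a => (s, a)

/-- What the agents hold in mind at one time: `c i` consists of agent `i`'s version
of the joint state and of agent `i`'s version of the joint action. The `i`-th components of `c i`
are the true local state and the action that agent `i` executes; the `j`-th components of `c i`, for
`j ≠ i`, belong to agent `i`'s copy of its teammate `j`. -/
abbrev Beliefs (S A : ι → Type*) : Type _ := ι → Joint S A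

/-- The true joint state and the joint action that is really executed. -/
def Beliefs.actual (c : Beliefs S A) : Joint S A :=
  (fun i => (c i).1 i, fun i => (c i).2 i)

/-- Communication has been available at all times `0, …, t`, where `t` is the length of the true
joint history `w = s₀ a₀ … sₜ₋₁ aₜ₋₁`. -/
def Connected (f : List (Joint S A) → Bool) (w : List (Joint S A)) : Prop :=
  ∀ u, u <+: w → f u = true

/-- One step of policy execution with imaginary play. Before the first loss of communication the
agents share the true joint state and one joint action drawn from the joint policy.
From the first loss on, every agent draws the states of its copies of its teammates and a
joint action on its own, independently of the other agents. -/
def Game.nextImaginary (G : Game ι S A) (π : Policy S A) (f : List (Joint S A) → Bool)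
    (h : List (Beliefs S A)) : PMF (Beliefs S A) :=
  open Classical in
  if Connected f (h.map Beliefs.actual) then
    (G.nextJoint π (h.map Beliefs.actual).getLast?).map fun x _ => x
  else
    piPMF fun i => G.nextJoint π (h.getLast?.map fun c => c i)

variable [∀ i, MeasurableSpace (S i)] [∀ i, MeasurableSingletonClass (S i)]
  [∀ i, MeasurableSpace (A i)] [∀ i, MeasurableSingletonClass (A i)]

/-- The law of the joint path `s₀ a₀ s₁ a₁ …` under full communication. -/
def Game.fullLaw (G : Game ι S A) (π : Policy S A) : Measure (ℕ → Joint S A) :=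
  processLaw fun h => G.nextJoint π h.getLast?

/-- The law of the joint path `s₀ a₀ s₁ a₁ …` that is really followed under imaginary play, when
communication is available at time `t` if and only if `f` takes the value `true` at the true joint
history `s₀ a₀ … sₜ₋₁ aₜ₋₁`. -/
def Game.imaginaryLaw (G : Game ι S A) (π : Policy S A) (f : List (Joint S A) → Bool) :
    Measure (ℕ → Joint S A) :=
  (processLaw (G.nextImaginary π f)).map fun c t => (c t).actual

/-- The law of the joint path under imaginary play without any communication. -/
def Game.imaginaryLawZero (G : Game ι S A) (π : Policy S A) : Measure (ℕ → Joint S A) :=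
  G.imaginaryLaw π fun _ => false

/-- The law of the path of agent `i` under full communication. -/
def Game.agentLaw (G : Game ι S A) (π : Policy S A) (i : ι) : Measure (ℕ → S i × A i) :=
  (G.fullLaw π).map fun x t => ((x t).1 i, (x t).2 i)

/-- The total correlation of the joint policy: the Kullback-Leibler divergence from the law of
the joint path to the product of the laws of the paths of the single agents. -/
def Game.totalCorrelation (G : Game ι S A) (π : Policy S A) : ℝ≥0∞ :=
  klDiv (G.fullLaw π)
    ((Measure.pi (G.agentLaw π)).map fun y t => (fun i => (y i t).1, fun i => (y i t).2))

end Execution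

end

end ImaginaryPlay

open Filter Topology

/-! At a finite horizon, the divergence is the negative entropy of the full law minus the expected
log-probability that imaginary play gives to a word. So communication has to be shown to raise this
expectation. Without communication the agents draw independent words, each from its own marginal,
and play is a product law.

`sum_mul_log_prod_le_imagProb` compares play under `f` with any product of sub-probability laws, by
induction on the word length. If communication is lost at once, the log of the product splits over
the agents, and Gibbs' inequality makes the conditional marginals the best factors. If it is
available, each factor splits into a first-letter marginal and a conditional law of the rest: by
Gibbs the true next-letter law beats the product of first-letter marginals, and the conditionals
again form a product. Products must be arbitrary because an agent's law given its own first letter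
need not be its law given the joint first letter.

`klDiv_le_of_forall_klDiv_map_le` passes to infinite paths by martingale convergence. Without
communication, play has the word probabilities of the product of agent laws, which gives the total
correlation; the entropy formula comes from integrating the log-ratio of atoms. -/

/-! ### Divergence along a filtration -/

theorem le_klFun_div {B x : ℝ} (hB : 0 < B) (hx : Real.exp (B + 1) ≤ x) :
    x ≤ B⁻¹ * klFun x := by
  have hx0 : 0 < x := (Real.exp_pos _).trans_le hx
  have hlog : B + 1 ≤ Real.log x := (Real.le_log_iff_exp_le hx0).2 hx
  rw [inv_mul_eq_div, le_div_iff₀ hB, klFun_apply]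
  -- Here `klFun x = x * log x + 1 - x`, which is at least `B * x + 1` once `log x ≥ B + 1`.
  nlinarith

/-- A family of nonnegative functions whose `klFun`-integrals are bounded
is uniformly integrable. -/
theorem uniformIntegrable_of_lintegral_klFun_le {κ Ω : Type*} {m : MeasurableSpace Ω}
    {Q : Measure Ω} [IsFiniteMeasure Q] {D : κ → Ω → ℝ} (hD : ∀ n, AEStronglyMeasurable (D n) Q)
    (hD0 : ∀ n ω, 0 ≤ D n ω) {C : ℝ≥0∞} (hC : C ≠ ∞)
    (h : ∀ n, ∫⁻ ω, ENNReal.ofReal (klFun (D n ω)) ∂Q ≤ C) : UniformIntegrable D 1 Q := by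
  refine uniformIntegrable_of le_rfl ENNReal.one_ne_top hD fun ε hε => ?_
  -- The tail above `exp (B + 1)` has integral at most `C / B`, which this `B` makes at most `ε`;
  -- the `+ 1` keeps `B` positive when `C = 0`.
  set B : ℝ := C.toReal / ε + 1 with hBdef
  have hB : 0 < B := by positivity
  refine ⟨(Real.exp (B + 1)).toNNReal, fun n => ?_⟩
  rw [eLpNorm_one_eq_lintegral_enorm]
  calc ∫⁻ ω, ‖({x | _ ≤ ‖D n x‖₊}.indicator (D n)) ω‖ₑ ∂Q
      ≤ ∫⁻ ω, ENNReal.ofReal B⁻¹ * ENNReal.ofReal (klFun (D n ω)) ∂Q := by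
        refine lintegral_mono fun ω => ?_
        by_cases hω : ω ∈ {x | (Real.exp (B + 1)).toNNReal ≤ ‖D n x‖₊}
        · rw [Set.indicator_of_mem hω, Real.enorm_eq_ofReal (hD0 n ω),
            ← ENNReal.ofReal_mul (by positivity)]
          refine ENNReal.ofReal_le_ofReal (le_klFun_div hB ?_)
          have := Real.toNNReal_le_iff_le_coe.1 hω
          rwa [coe_nnnorm, Real.norm_of_nonneg (hD0 n ω)] at this
        · rw [Set.indicator_of_notMem hω, enorm_zero]
          exact zero_le
    _ = ENNReal.ofReal B⁻¹ * ∫⁻ ω, ENNReal.ofReal (klFun (D n ω)) ∂Q :=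
        lintegral_const_mul' _ _ ENNReal.ofReal_ne_top
    _ ≤ ENNReal.ofReal B⁻¹ * C := by gcongr; exact h n
    _ ≤ ENNReal.ofReal ε := by
        rw [← ENNReal.ofReal_toReal hC, ← ENNReal.ofReal_mul (by positivity)]
        refine ENNReal.ofReal_le_ofReal ?_
        rw [inv_mul_eq_div, div_le_iff₀ hB, hBdef, mul_add, mul_div_cancel₀ _ hε.ne']
        linarith

/-- Two finite measures that agree along a filtration that generates the σ-algebra are equal. -/
theorem measure_ext_of_filtration {Ω : Type*} {m : MeasurableSpace Ω} {μ ν : Measure Ω}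
    [IsFiniteMeasure μ] (ℱ : Filtration ℕ m) (hsup : ⨆ n, ℱ n = m)
    (h : ∀ n, ∀ s : Set Ω, MeasurableSet[ℱ n] s → μ s = ν s) : μ = ν := by
  refine ext_of_generate_finite (⋃ n, {s | MeasurableSet[ℱ n] s}) ?_ ?_ ?_
    (h 0 _ MeasurableSet.univ)
  · refine hsup.symm.trans ((MeasurableSpace.measurableSpace_iSup_eq _).trans ?_)
    congr 1
    ext s
    simp
  · exact isPiSystem_iUnion_of_monotone _
      (fun n => @MeasurableSpace.isPiSystem_measurableSet _ (ℱ n)) fun a b hab s hs =>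
        ℱ.mono hab s hs
  · rintro s hs
    obtain ⟨n, hn⟩ := Set.mem_iUnion.1 hs
    exact h n s hn

/-- The Kullback-Leibler divergence is determined by the finite-time divergences along a
filtration that generates the σ-algebra. -/
theorem klDiv_le_of_forall_klDiv_map_le {Ω : Type*} {m : MeasurableSpace Ω} {P Q : Measure Ω}
    [IsProbabilityMeasure P] [IsProbabilityMeasure Q] {Y : ℕ → Type*}
    [∀ n, MeasurableSpace (Y n)] {g : ∀ n, Ω → Y n} (ℱ : Filtration ℕ m)
    (hℱ : ∀ n, ℱ n = MeasurableSpace.comap (g n) inferInstance) (hsup : ⨆ n, ℱ n = m)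
    {C : ℝ≥0∞} (h : ∀ n, klDiv (P.map (g n)) (Q.map (g n)) ≤ C) : klDiv P Q ≤ C := by
  rcases eq_or_ne C ∞ with rfl | hC
  · exact le_top
  have hcm : ∀ n, Measurable[ℱ n] (g n) := fun n => by
    rw [hℱ]; exact comap_measurable _
  have hg : ∀ n, Measurable (g n) := fun n => (hcm n).mono (ℱ.le n) le_rfl
  have hac : ∀ n, P.map (g n) ≪ Q.map (g n) := fun n =>
    (klDiv_ne_top_iff.1 ((h n).trans_lt (lt_top_iff_ne_top.2 hC)).ne).1
  have hPn : ∀ n, IsProbabilityMeasure (P.map (g n)) := fun n =>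
    Measure.isProbabilityMeasure_map (hg n).aemeasurable
  have hQn : ∀ n, IsProbabilityMeasure (Q.map (g n)) := fun n =>
    Measure.isProbabilityMeasure_map (hg n).aemeasurable
  -- `P ≪ Q` is known only at finite times. The finite-time densities form a `Q`-martingale, and its
  -- limit `L` will be the density of `P`.
  set D : ℕ → Ω → ℝ := fun n ω => ((P.map (g n)).rnDeriv (Q.map (g n)) (g n ω)).toReal
  have hmeas : ∀ n, StronglyMeasurable[ℱ n] (D n) := fun n =>
    (((Measure.measurable_rnDeriv _ _).ennreal_toReal).comp (hcm n)).stronglyMeasurable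
  have hmeas' : ∀ n, StronglyMeasurable (D n) := fun n => (hmeas n).mono (ℱ.le n)
  have hD0 : ∀ n ω, 0 ≤ D n ω := fun n ω => ENNReal.toReal_nonneg
  have hint : ∀ n, Integrable (D n) Q := fun n =>
    (Measure.integrable_toReal_rnDeriv (μ := P.map (g n)) (ν := Q.map (g n))).comp_measurable
      (hg n)
  have hset : ∀ n, ∀ s : Set Ω, MeasurableSet[ℱ n] s → ∫ ω in s, D n ω ∂Q = P.real s := by
    intro n s hs
    rw [hℱ] at hs
    obtain ⟨t, ht, rfl⟩ := hs
    rw [← setIntegral_map (f := fun y => ((P.map (g n)).rnDeriv (Q.map (g n)) y).toReal) ht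
      (Measure.measurable_rnDeriv _ _).ennreal_toReal.aestronglyMeasurable (hg n).aemeasurable,
      Measure.setIntegral_toReal_rnDeriv (hac n), map_measureReal_apply (hg n) ht]
  have hmart : Martingale D ℱ Q := martingale_of_setIntegral_eq_succ hmeas hint fun n s hs => by
    rw [hset n s hs, hset (n + 1) s (ℱ.mono n.le_succ s hs)]
  have hkl : ∀ n, ∫⁻ ω, ENNReal.ofReal (klFun (D n ω)) ∂Q ≤ C := fun n => by
    refine le_trans (le_of_eq ?_) (h n)
    rw [klDiv_eq_lintegral_klFun_of_ac (hac n), lintegral_map (by fun_prop) (hg n)]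
  have hUI := uniformIntegrable_of_lintegral_klFun_le
    (fun n => (hmeas' n).aestronglyMeasurable) hD0 hC hkl
  set L := Filtration.limitProcess D ℱ Q
  have hlim : ∀ᵐ ω ∂Q, Tendsto (fun n => D n ω) atTop (𝓝 (L ω)) :=
    hmart.submartingale.ae_tendsto_limitProcess_of_uniformIntegrable hUI
  have hL0 : 0 ≤ᵐ[Q] L := by
    filter_upwards [hlim] with ω hω using ge_of_tendsto' hω fun n => hD0 n ω
  obtain ⟨R, hR⟩ := hUI.2.2
  have hLint : Integrable L Q :=
    (Filtration.memLp_limitProcess_of_eLpNorm_bdd hUI.1 hR).integrable le_rfl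
  -- Uniform integrability makes `D n` the conditional expectation of `L`, so no mass escapes in the
  -- limit.
  have hLset : ∀ n, ∀ s : Set Ω, MeasurableSet[ℱ n] s → ∫ ω in s, L ω ∂Q = P.real s := by
    intro n s hs
    rw [← hset n s hs, ← setIntegral_condExp (ℱ.le n) hLint hs]
    exact setIntegral_congr_ae (ℱ.le n s hs)
      ((hmart.ae_eq_condExp_limitProcess hUI n).mono fun ω hω _ => hω.symm)
  have hPQ : P = Q.withDensity fun ω => ENNReal.ofReal (L ω) := by
    refine measure_ext_of_filtration ℱ hsup fun n s hs => ?_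
    rw [withDensity_apply _ (ℱ.le n s hs), ← ofReal_integral_eq_lintegral_ofReal
      hLint.integrableOn (ae_restrict_of_ae hL0), hLset n s hs, ofReal_measureReal]
  have hPQac : P ≪ Q := hPQ ▸ withDensity_absolutelyContinuous _ _
  have hrn : P.rnDeriv Q =ᵐ[Q] fun ω => ENNReal.ofReal (L ω) := by
    rw [hPQ]
    exact Measure.rnDeriv_withDensity₀ _ hLint.aemeasurable.ennreal_ofReal
  rw [klDiv_eq_lintegral_klFun_of_ac hPQac]
  -- Fatou's lemma, with `klFun` continuous and nonnegative.
  calc ∫⁻ ω, ENNReal.ofReal (klFun (P.rnDeriv Q ω).toReal) ∂Q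
      = ∫⁻ ω, liminf (fun n => ENNReal.ofReal (klFun (D n ω))) atTop ∂Q := by
        refine lintegral_congr_ae ?_
        filter_upwards [hlim, hrn, hL0] with ω h1 h2 h3
        rw [h2, ENNReal.toReal_ofReal h3]
        exact ((ENNReal.continuous_ofReal.tendsto _).comp
          ((continuous_klFun.tendsto _).comp h1)).liminf_eq.symm
    _ ≤ liminf (fun n => ∫⁻ ω, ENNReal.ofReal (klFun (D n ω)) ∂Q) atTop :=
        lintegral_liminf_le fun n =>
          (measurable_klFun.comp (hmeas' n).measurable).ennreal_ofReal
    _ ≤ C := liminf_le_of_le (by isBoundedDefault) fun b hb =>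
        let ⟨n, hn⟩ := hb.exists; hn.trans (hkl n)

/-! ### Divergence on finite spaces and Gibbs' inequality -/

theorem rnDeriv_singleton_mul {X : Type*} [MeasurableSpace X] [MeasurableSingletonClass X]
    {μ ν : Measure X} [IsFiniteMeasure μ] [IsFiniteMeasure ν] (h : μ ≪ ν) (x : X) :
    (μ.rnDeriv ν x).toReal * ν.real {x} = μ.real {x} := by
  rw [← Measure.setIntegral_toReal_rnDeriv h {x}, integral_singleton, smul_eq_mul, mul_comm]

theorem llr_of_singleton_ne_zero {X : Type*} [MeasurableSpace X] [MeasurableSingletonClass X]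
    {μ ν : Measure X} [IsFiniteMeasure μ] [IsFiniteMeasure ν] (h : μ ≪ ν) {x : X}
    (hx : μ.real {x} ≠ 0) : llr μ ν x = Real.log (μ.real {x}) - Real.log (ν.real {x}) := by
  have hmul := rnDeriv_singleton_mul h x
  have hν : ν.real {x} ≠ 0 := fun h0 => hx (by rw [← hmul, h0, mul_zero])
  rw [llr, ← Real.log_div hx hν, ← hmul, mul_div_cancel_right₀ _ hν]

theorem absolutelyContinuous_of_forall_singleton {X : Type*} [Countable X] [MeasurableSpace X]
    [MeasurableSingletonClass X] {μ ν : Measure X} [IsFiniteMeasure μ] [IsFiniteMeasure ν]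
    (h : ∀ x, 0 < μ.real {x} → 0 < ν.real {x}) : μ ≪ ν := by
  intro s hs
  rw [← Set.biUnion_of_singleton s, measure_biUnion_null_iff s.to_countable]
  intro x hx
  by_contra hne
  have h1 := h x (ENNReal.toReal_pos hne (measure_ne_top _ _))
  rw [measureReal_def, measure_mono_null (Set.singleton_subset_iff.2 hx) hs] at h1
  simp at h1

theorem klDiv_of_finite {X : Type*} [Fintype X] [MeasurableSpace X]
    [MeasurableSingletonClass X] {μ ν : Measure X} [IsProbabilityMeasure μ]
    [IsProbabilityMeasure ν] (h : ∀ x, 0 < μ.real {x} → 0 < ν.real {x}) :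
    klDiv μ ν = ENNReal.ofReal (∑ x, μ.real {x} * Real.log (μ.real {x}) -
      ∑ x, μ.real {x} * Real.log (ν.real {x})) := by
  have hac := absolutelyContinuous_of_forall_singleton h
  rw [klDiv_of_ac_of_integrable hac .of_finite, integral_fintype .of_finite,
    ← Finset.sum_sub_distrib]
  simp only [probReal_univ, add_sub_cancel_right, smul_eq_mul]
  congr 1
  refine Finset.sum_congr rfl fun x _ => ?_
  rcases eq_or_ne (μ.real {x}) 0 with h0 | h0
  · simp [h0]
  · rw [llr_of_singleton_ne_zero hac h0, mul_sub]

/-- Gibbs' inequality, from `log t ≤ t - 1` at `t = q k / p k`. The mass of `q` may be smaller than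
that of `p`, which leaves room for sub-probability factors and for tuples that are no joint letter.
-/
theorem sum_mul_log_le_sum_mul_log {κ : Type*} [Fintype κ] {p q : κ → ℝ} (hp : ∀ k, 0 ≤ p k)
    (hq : ∀ k, 0 ≤ q k) (hpos : ∀ k, 0 < p k → 0 < q k) (hsum : ∑ k, q k ≤ ∑ k, p k) :
    ∑ k, p k * Real.log (q k) ≤ ∑ k, p k * Real.log (p k) := by
  have hterm : ∀ k, p k * Real.log (q k) - p k * Real.log (p k) ≤ q k - p k := fun k => by
    rcases (hp k).eq_or_lt with h0 | h0
    · simpa [← h0] using hq k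
    · rw [← mul_sub, ← Real.log_div (hpos k h0).ne' h0.ne']
      calc p k * Real.log (q k / p k) ≤ p k * (q k / p k - 1) := by
            gcongr; exact Real.log_le_sub_one_of_pos (div_pos (hpos k h0) h0)
        _ = q k - p k := by field_simp
  have := Finset.sum_le_sum fun k (_ : k ∈ Finset.univ) => hterm k
  rw [Finset.sum_sub_distrib, Finset.sum_sub_distrib] at this
  linarith

theorem PMF.sum_toReal {X : Type*} [Fintype X] (p : PMF X) : ∑ x, (p x).toReal = 1 := by
  rw [← ENNReal.toReal_sum fun x _ => p.apply_ne_top x, ← tsum_fintype (L := .unconditional _),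
    p.tsum_coe, ENNReal.toReal_one]

theorem sum_ofFn_succ {X M : Type*} [Fintype X] [AddCommMonoid M] {m : ℕ} (F : List X → M) :
    ∑ w : Fin (m + 1) → X, F (List.ofFn w) =
      ∑ x, ∑ v : Fin m → X, F (x :: List.ofFn v) := by
  rw [← Fintype.sum_prod_type', ← (Fin.consEquiv fun _ => X).sum_comp]
  refine Fintype.sum_congr _ _ fun a => ?_
  simp [Fin.consEquiv, List.ofFn_succ]

/-! ### Probabilities of finite words -/

namespace ImaginaryPlay

noncomputable section

/-- The probability that, after the history `h`, the images under `φ` of the next letters of the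
process are the letters of a given word. -/
def obsProb {X Y : Type*} [Fintype X] (next : List X → PMF X) (φ : X → Y) :
    List X → List Y → ℝ
  | _, [] => 1
  | h, y :: w => open Classical in
    ∑ x, if φ x = y then (next h x).toReal * obsProb next φ (h ++ [x]) w else 0

section Words

variable {X Y : Type*} [Fintype X] (next : List X → PMF X) (φ : X → Y)

theorem obsProb_nonneg (h : List X) (w : List Y) : 0 ≤ obsProb next φ h w := by
  induction w generalizing h with
  | nil => exact zero_le_one
  | cons y w ih =>
    refine Finset.sum_nonneg fun x _ => ?_
    split_ifs
    · exact mul_nonneg ENNReal.toReal_nonneg (ih _)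
    · exact le_rfl

theorem obsProb_id_cons (h : List X) (x : X) (w : List X) :
    obsProb next id h (x :: w) = (next h x).toReal * obsProb next id (h ++ [x]) w := by
  classical
  rw [obsProb]
  simp

/-- `obsProb` reads a word from the front, whereas path measures grow at the end; this reconciles
the two. -/
theorem obsProb_id_concat (h w : List X) (x : X) :
    obsProb next id h (w ++ [x]) = obsProb next id h w * (next (h ++ w) x).toReal := by
  induction w generalizing h with
  | nil => rw [List.nil_append, obsProb_id_cons]; simp [obsProb]
  | cons y w ih => rw [List.cons_append, obsProb_id_cons, obsProb_id_cons, ih]; simp [mul_assoc]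

theorem sum_obsProb [Fintype Y] (m : ℕ) (h : List X) :
    ∑ w : Fin m → Y, obsProb next φ h (List.ofFn w) = 1 := by
  classical
  induction m generalizing h with
  | zero => simp [obsProb]
  | succ m ih =>
    rw [sum_ofFn_succ]
    simp only [obsProb]
    calc ∑ y, ∑ v : Fin m → Y, ∑ x, (if φ x = y then
            (next h x).toReal * obsProb next φ (h ++ [x]) (List.ofFn v) else 0)
        = ∑ y, ∑ x, ∑ v : Fin m → Y, (if φ x = y then
            (next h x).toReal * obsProb next φ (h ++ [x]) (List.ofFn v) else 0) :=
          Fintype.sum_congr _ _ fun y => Finset.sum_comm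
      _ = ∑ y, ∑ x, (if φ x = y then (next h x).toReal else 0) := by
          refine Fintype.sum_congr _ _ fun y => Fintype.sum_congr _ _ fun x => ?_
          split_ifs
          · rw [← Finset.mul_sum, ih, mul_one]
          · simp
      _ = 1 := by rw [Finset.sum_comm]; simp [PMF.sum_toReal]

open Classical in
-- Observing letter by letter amounts to drawing the whole word and then applying `φ`, so observed
-- words follow a marginal of the hidden law.
theorem obsProb_eq_sum (m : ℕ) (h : List X) (w : Fin m → Y) :
    obsProb next φ h (List.ofFn w) =
      ∑ v : Fin m → X, if φ ∘ v = w then obsProb next id h (List.ofFn v) else 0 := by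
  induction m generalizing h with
  | zero => simp [obsProb, Subsingleton.elim _ w]
  | succ m ih =>
    rw [← (Fin.consEquiv fun _ => X).sum_comp, Fintype.sum_prod_type, List.ofFn_succ, obsProb]
    refine Fintype.sum_congr _ _ fun x => ?_
    have hiff : ∀ v : Fin m → X, φ ∘ (Fin.consEquiv fun _ => X) (x, v) = w ↔
        φ x = w 0 ∧ φ ∘ v = fun k => w k.succ := fun v => by
      simp [funext_iff, Fin.forall_fin_succ, Fin.consEquiv]
    have hof : ∀ v : Fin m → X, List.ofFn ((Fin.consEquiv fun _ => X) (x, v)) =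
        x :: List.ofFn v := fun v => by simp [Fin.consEquiv, List.ofFn_succ]
    simp only [hiff, hof, obsProb_id_cons]
    by_cases hx : φ x = w 0
    · simp only [hx, true_and, if_true, ih, Finset.mul_sum, mul_ite, mul_zero]
    · simp [hx]

theorem obsProb_map_pos {m : ℕ} {h : List X} {w : Fin m → X}
    (hw : 0 < obsProb next id h (List.ofFn w)) :
    0 < obsProb next φ h ((List.ofFn w).map φ) := by
  classical
  rw [List.map_ofFn, obsProb_eq_sum]
  refine hw.trans_le ?_
  refine le_trans (by simp) (Finset.single_le_sum (f := fun v : Fin m → X =>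
    if φ ∘ v = φ ∘ w then obsProb next id h (List.ofFn v) else 0) (fun v _ => ?_)
    (Finset.mem_univ w))
  split_ifs
  · exact obsProb_nonneg _ _ _ _
  · exact le_rfl

theorem sum_obsProb_id_mul_map [Fintype Y] (m : ℕ) (h : List X) (F : List Y → ℝ) :
    ∑ w : Fin m → X, obsProb next id h (List.ofFn w) * F ((List.ofFn w).map φ) =
      ∑ v : Fin m → Y, obsProb next φ h (List.ofFn v) * F (List.ofFn v) := by
  classical
  simp only [obsProb_eq_sum next φ, Finset.sum_mul, List.map_ofFn]
  rw [Finset.sum_comm]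
  refine Fintype.sum_congr _ _ fun w => ?_
  simp [ite_mul]

end Words

/-! ### Optimality of imaginary play among product laws -/

section Imaginary

variable {ι X : Type*} [Fintype ι] [Fintype X] {Y : ι → Type*} (proj : ∀ i, X → Y i)
  (next : List X → PMF X) (f : List X → Bool)

/-- The probability that imaginary play continues a connected history `h` by a given word. -/
def imagProb : List X → List X → ℝ
  | _, [] => 1
  | h, x :: w =>
    if f h = true then (next h x).toReal * imagProb (h ++ [x]) w
    -- The current letter `x` is already drawn without communication. The loss is permanent, so `f`
    -- is not consulted again.
    else ∏ i, obsProb next (proj i) h ((x :: w).map (proj i))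

/-- Every marginal of a possible joint word is possible. This keeps the logarithms meaningful and
yields absolute continuity at finite times. -/
theorem imagProb_pos {m : ℕ} {h : List X} {w : Fin m → X}
    (hw : 0 < obsProb next id h (List.ofFn w)) : 0 < imagProb proj next f h (List.ofFn w) := by
  induction m generalizing h with
  | zero => simp [imagProb]
  | succ m ih =>
    by_cases hf : f h = true
    · rw [List.ofFn_succ, obsProb_id_cons] at hw
      rw [List.ofFn_succ, imagProb, if_pos hf]
      exact mul_pos (pos_of_mul_pos_left hw (obsProb_nonneg _ _ _ _))
        (ih (pos_of_mul_pos_right hw ENNReal.toReal_nonneg))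
    · have := fun i => obsProb_map_pos next (proj i) hw
      rw [List.ofFn_succ] at this ⊢
      rw [imagProb, if_neg hf]
      exact Finset.prod_pos fun i _ => this i

variable [∀ i, Fintype (Y i)]

/-- The log of the product turns the joint expectation into one sum per agent, taken against that
agent's marginal; Gibbs' inequality applies to each. -/
theorem sum_mul_log_prod_le_marginals {m : ℕ} {h : List X} {R : ∀ i, List (Y i) → ℝ}
    (hR0 : ∀ i w, 0 ≤ R i w) (hR1 : ∀ i, ∑ w : Fin m → Y i, R i (List.ofFn w) ≤ 1)
    (hpos : ∀ w : Fin m → X, 0 < obsProb next id h (List.ofFn w) →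
      ∀ i, 0 < R i ((List.ofFn w).map (proj i))) :
    ∑ w : Fin m → X, obsProb next id h (List.ofFn w) *
        Real.log (∏ i, R i ((List.ofFn w).map (proj i))) ≤
      ∑ w : Fin m → X, obsProb next id h (List.ofFn w) *
        Real.log (∏ i, obsProb next (proj i) h ((List.ofFn w).map (proj i))) := by
  classical
  have key : ∀ T : ∀ i, List (Y i) → ℝ, (∀ w : Fin m → X, 0 < obsProb next id h (List.ofFn w) →
      ∀ i, 0 < T i ((List.ofFn w).map (proj i))) →
      ∑ w : Fin m → X, obsProb next id h (List.ofFn w) *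
        Real.log (∏ i, T i ((List.ofFn w).map (proj i))) =
      ∑ i, ∑ v : Fin m → Y i, obsProb next (proj i) h (List.ofFn v) *
        Real.log (T i (List.ofFn v)) := by
    intro T hT
    simp only [← sum_obsProb_id_mul_map next (proj _) m h fun v => Real.log (T _ v)]
    rw [Finset.sum_comm]
    refine Fintype.sum_congr _ _ fun w => ?_
    rcases (obsProb_nonneg next id h (List.ofFn w)).eq_or_lt with h0 | h0
    · simp [← h0]
    · rw [Real.log_prod fun i _ => (hT w h0 i).ne', Finset.mul_sum]
  rw [key R hpos, key _ fun w hw i => obsProb_map_pos next (proj i) hw]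
  refine Finset.sum_le_sum fun i _ => sum_mul_log_le_sum_mul_log
    (fun _ => obsProb_nonneg _ _ _ _) (fun _ => hR0 i _) (fun v hv => ?_)
    ((hR1 i).trans_eq (sum_obsProb next (proj i) m h).symm)
  -- A possible word of agent `i` lifts to a possible joint word, to which `hpos` applies.
  rw [obsProb_eq_sum] at hv
  obtain ⟨w, -, hw⟩ := Finset.exists_lt_of_sum_lt (f := fun _ => (0 : ℝ)) (by simpa using hv)
  split_ifs at hw with hwv
  · subst hwv
    simpa [List.map_ofFn] using hpos w hw i
  · exact absurd hw (lt_irrefl _)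

/-- Among all products of laws of the words of the single agents, none is closer to the law of the
joint words than the law of imaginary play. -/
theorem sum_mul_log_prod_le_imagProb (hinj : Function.Injective fun x i => proj i x) {m : ℕ}
    {h : List X} {R : ∀ i, List (Y i) → ℝ} (hR0 : ∀ i w, 0 ≤ R i w)
    (hR1 : ∀ i, ∑ w : Fin m → Y i, R i (List.ofFn w) ≤ 1)
    (hpos : ∀ w : Fin m → X, 0 < obsProb next id h (List.ofFn w) →
      ∀ i, 0 < R i ((List.ofFn w).map (proj i))) :
    ∑ w : Fin m → X, obsProb next id h (List.ofFn w) *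
        Real.log (∏ i, R i ((List.ofFn w).map (proj i))) ≤
      ∑ w : Fin m → X, obsProb next id h (List.ofFn w) *
        Real.log (imagProb proj next f h (List.ofFn w)) := by
  classical
  -- Both vary: the first letter extends `h` and replaces `R` by its conditional laws.
  induction m generalizing h R with
  | zero =>
    simp only [Finset.univ_unique, Finset.sum_singleton, List.ofFn_zero, List.map_nil, imagProb,
      obsProb, one_mul, Real.log_one]
    exact Real.log_nonpos (Finset.prod_nonneg fun i _ => hR0 i _)
      (Finset.prod_le_one (fun i _ => hR0 i _) fun i _ => by simpa using hR1 i)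
  | succ m ih =>
    by_cases hf : f h = true
    swap
    · refine (sum_mul_log_prod_le_marginals proj next hR0 hR1 hpos).trans_eq ?_
      refine Fintype.sum_congr _ _ fun w => ?_
      rw [List.ofFn_succ, imagProb, if_neg hf]
    set r : ∀ i, Y i → ℝ := fun i y => ∑ v : Fin m → Y i, R i (y :: List.ofFn v) with hr
    have hr0 : ∀ i y, 0 ≤ r i y := fun i y => Finset.sum_nonneg fun v _ => hR0 i _
    have hr1 : ∑ x, ∏ i, r i (proj i x) ≤ ∑ x, (next h x).toReal := by
      rw [PMF.sum_toReal]
      -- By injectivity the joint letters form a subset of all tuples, over which the sum of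
      -- products factors.
      calc ∑ x, ∏ i, r i (proj i x) ≤ ∑ y : ∀ i, Y i, ∏ i, r i (y i) := by
            rw [← Finset.sum_image (s := Finset.univ) (g := fun x i => proj i x)
              (f := fun y : ∀ i, Y i => ∏ i, r i (y i)) hinj.injOn]
            exact Finset.sum_le_sum_of_subset_of_nonneg (Finset.subset_univ _)
              fun y _ _ => Finset.prod_nonneg fun i _ => hr0 i _
        _ = ∏ i, ∑ y, r i y := (Fintype.prod_sum _).symm
        _ ≤ 1 := Finset.prod_le_one (fun i _ => Finset.sum_nonneg fun y _ => hr0 i y) fun i _ => by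
            rw [hr, ← sum_ofFn_succ]; exact hR1 i
    have hposc : ∀ x, 0 < (next h x).toReal → ∀ v : Fin m → X,
        0 < obsProb next id (h ++ [x]) (List.ofFn v) → ∀ i,
        0 < R i (proj i x :: (List.ofFn v).map (proj i)) := fun x hx v hv i => by
      simpa [List.ofFn_succ] using hpos (Fin.cons x v) (by
        simpa [List.ofFn_succ, obsProb_id_cons] using mul_pos hx hv) i
    have hRr : ∀ i y (v : Fin m → Y i), R i (y :: List.ofFn v) ≤ r i y := fun i y v =>
      Finset.single_le_sum (f := fun v : Fin m → Y i => R i (y :: List.ofFn v))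
        (fun v _ => hR0 i _) (Finset.mem_univ v)
    have hrpos : ∀ x, 0 < (next h x).toReal → ∀ i, 0 < r i (proj i x) := fun x hx i => by
      obtain ⟨v, -, hv⟩ := Finset.exists_lt_of_sum_lt (s := Finset.univ) (f := fun _ => (0 : ℝ))
        (g := fun v : Fin m → X => obsProb next id (h ++ [x]) (List.ofFn v))
        (by rw [sum_obsProb]; simp)
      have := hposc x hx v hv i
      rw [List.map_ofFn] at this
      exact this.trans_le (hRr i _ _)
    rw [sum_ofFn_succ fun w => obsProb next id h w * Real.log (∏ i, R i (w.map (proj i))),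
      sum_ofFn_succ fun w => obsProb next id h w * Real.log (imagProb proj next f h w)]
    have hstep : ∀ x, ∑ v : Fin m → X, obsProb next id h (x :: List.ofFn v) *
          Real.log (∏ i, R i ((x :: List.ofFn v).map (proj i))) ≤
        (next h x).toReal * Real.log (∏ i, r i (proj i x)) + (next h x).toReal *
          ∑ v : Fin m → X, obsProb next id (h ++ [x]) (List.ofFn v) *
            Real.log (imagProb proj next f (h ++ [x]) (List.ofFn v)) := by
      intro x
      simp only [obsProb_id_cons, List.map_cons, mul_assoc, ← Finset.mul_sum, ← mul_add]
      rcases (ENNReal.toReal_nonneg (a := next h x)).eq_or_lt with hx | hx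
      · simp [← hx]
      refine mul_le_mul_of_nonneg_left ?_ hx.le
      -- The factors conditioned on their first letters; normalisation is exact because `r i` sums
      -- out the rest.
      have hih := ih (h := h ++ [x]) (R := fun i w => R i (proj i x :: w) / r i (proj i x))
        (fun i w => div_nonneg (hR0 i _) (hr0 i _))
        (fun i => by rw [← Finset.sum_div]; exact (div_self (hrpos x hx i).ne').le)
        (fun v hv i => div_pos (hposc x hx v hv i) (hrpos x hx i))
      refine le_trans (le_of_eq ?_) (add_le_add_right hih _)
      -- The constant logarithm enters the sum by writing `1` as the total probability of the
      -- continuations.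
      rw [← one_mul (Real.log (∏ i, r i (proj i x))), ← sum_obsProb next id m (h ++ [x]),
        Finset.sum_mul, ← Finset.sum_add_distrib]
      refine Fintype.sum_congr _ _ fun v => ?_
      rcases (obsProb_nonneg next id (h ++ [x]) (List.ofFn v)).eq_or_lt with h0 | h0
      · simp [← h0]
      · rw [Finset.prod_div_distrib, Real.log_div
          (Finset.prod_pos fun i _ => hposc x hx v h0 i).ne'
          (Finset.prod_pos fun i _ => hrpos x hx i).ne']
        ring
    refine (Finset.sum_le_sum fun x _ => hstep x).trans ?_
    rw [Finset.sum_add_distrib]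
    -- Gibbs' inequality for the first letter: the gain from communicating once.
    refine (add_le_add_left (sum_mul_log_le_sum_mul_log (fun x => ENNReal.toReal_nonneg)
      (fun x => Finset.prod_nonneg fun i _ => hr0 i _)
      (fun x hx => Finset.prod_pos fun i _ => hrpos x hx i) hr1) _).trans_eq ?_
    rw [← Finset.sum_add_distrib]
    refine Fintype.sum_congr _ _ fun x => ?_
    rcases (ENNReal.toReal_nonneg (a := next h x)).eq_or_lt with hx | hx
    · simp [obsProb_id_cons, ← hx]
    simp only [obsProb_id_cons, imagProb, if_pos hf, mul_assoc, ← Finset.mul_sum, ← mul_add]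
    congr 1
    rw [← one_mul (Real.log (next h x).toReal), ← sum_obsProb next id m (h ++ [x]),
      Finset.sum_mul, ← Finset.sum_add_distrib]
    refine Fintype.sum_congr _ _ fun v => ?_
    rcases (obsProb_nonneg next id (h ++ [x]) (List.ofFn v)).eq_or_lt with h0 | h0
    · simp [← h0]
    · rw [Real.log_mul hx.ne' (imagProb_pos proj next f h0).ne']
      ring

end Imaginary

/-! ### Path measures and their finite-time marginals -/

/-- The first `n` letters of a sequence. -/
def trunc (X : Type*) (n : ℕ) (x : ℕ → X) : Fin n → X := fun k => x k

section Trunc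

variable {X : Type*} [MeasurableSpace X]

theorem measurable_trunc (n : ℕ) : Measurable (trunc X n) :=
  measurable_pi_lambda _ fun _ => measurable_pi_apply _

/-- The filtration generated by the letters of a sequence. -/
def truncFiltration (X : Type*) [MeasurableSpace X] :
    Filtration ℕ (inferInstance : MeasurableSpace (ℕ → X)) where
  seq n := MeasurableSpace.comap (trunc X n) inferInstance
  mono' n m hnm := by
    have hcomp : trunc X n = (fun w k => w (Fin.castLE hnm k)) ∘ trunc X m := rfl
    change MeasurableSpace.comap (trunc X n) _ ≤ MeasurableSpace.comap (trunc X m) _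
    rw [hcomp, ← MeasurableSpace.comap_comp]
    exact MeasurableSpace.comap_mono (Measurable.comap_le
      (measurable_pi_lambda _ fun k => measurable_pi_apply _))
  le' n := (measurable_trunc n).comap_le

theorem iSup_truncFiltration : ⨆ n, truncFiltration X n = MeasurableSpace.pi := by
  refine le_antisymm (iSup_le fun n => (truncFiltration X).le n) (iSup_le fun n => ?_)
  refine le_trans ?_ (le_iSup _ (n + 1))
  have hcomp : (fun x : ℕ → X => x n) = (fun w => w (Fin.last n)) ∘ trunc X (n + 1) := rfl
  rw [hcomp, ← MeasurableSpace.comap_comp]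
  exact MeasurableSpace.comap_mono (measurable_pi_apply _).comap_le

theorem ext_of_map_trunc [Finite X] [MeasurableSingletonClass X] {μ ν : Measure (ℕ → X)}
    [IsFiniteMeasure μ] [IsFiniteMeasure ν]
    (h : ∀ n w, (μ.map (trunc X n)).real {w} = (ν.map (trunc X n)).real {w}) : μ = ν := by
  have hmap : ∀ n, μ.map (trunc X n) = ν.map (trunc X n) := fun n =>
    Measure.ext_of_singleton fun w => by
      rw [← ofReal_measureReal, h n w, ofReal_measureReal]
  refine measure_ext_of_filtration (truncFiltration X) iSup_truncFiltration fun n s hs => ?_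
  obtain ⟨t, ht, rfl⟩ := hs
  rw [← Measure.map_apply (measurable_trunc n) ht, hmap, Measure.map_apply (measurable_trunc n) ht]

variable [MeasurableSingletonClass X]

instance isProbabilityMeasure_processLaw [Finite X] (next : List X → PMF X) :
    IsProbabilityMeasure (processLaw next) := by
  unfold processLaw; infer_instance

variable [Fintype X] (next : List X → PMF X)

theorem processLaw_eval_zero (x : X) :
    (processLaw next).real {y | y 0 = x} = (next [] x).toReal := by
  have hmap : (processLaw next).map (Preorder.frestrictLe (π := fun _ : ℕ => X) 0) =
      (next []).toMeasure.map (MeasurableEquiv.piUnique fun _ : Finset.Iic 0 => X).symm := by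
    rw [processLaw, Kernel.trajMeasure, Measure.map_comp _ _ (by fun_prop),
      Kernel.traj_map_frestrictLe, Kernel.partialTraj_self, Measure.id_comp]
  have hset : {y : ℕ → X | y 0 = x} = Preorder.frestrictLe (π := fun _ : ℕ => X) 0 ⁻¹'
      {u | u ⟨0, by simp⟩ = x} := rfl
  have hms : MeasurableSet {u : Finset.Iic 0 → X | u ⟨0, by simp⟩ = x} := by measurability
  rw [hset, measureReal_def, ← Measure.map_apply (by fun_prop) hms, hmap,
    Measure.map_apply (by fun_prop) hms]
  have hpre : (MeasurableEquiv.piUnique fun _ : Finset.Iic 0 => X).symm ⁻¹'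
      {u : Finset.Iic 0 → X | u ⟨0, by simp⟩ = x} = {x} := by
    ext z
    rfl
  erw [hpre]
  rw [PMF.toMeasure_apply_singleton _ _ (measurableSet_singleton x)]

theorem processLaw_map_trunc (n : ℕ) (w : Fin n → X) :
    ((processLaw next).map (trunc X n)).real {w} = obsProb next id [] (List.ofFn w) := by
  induction n with
  | zero =>
    have : IsProbabilityMeasure ((processLaw next).map (trunc X 0)) :=
      Measure.isProbabilityMeasure_map (measurable_trunc 0).aemeasurable
    rw [Set.eq_univ_of_forall (s := {w}) fun v => Subsingleton.elim _ _, probReal_univ]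
    simp [obsProb]
  | succ n ih =>
    rw [List.ofFn_succ', List.concat_eq_append, obsProb_id_concat, List.nil_append, ← ih,
      map_measureReal_apply (measurable_trunc _) (measurableSet_singleton _),
      map_measureReal_apply (measurable_trunc _) (measurableSet_singleton _)]
    -- The letter at time `0` comes from the initial law of `trajMeasure`, every later one from a
    -- kernel.
    cases n with
    | zero =>
      have h0 : trunc X 0 ⁻¹' {fun k : Fin 0 => w k.castSucc} = Set.univ :=
        Set.eq_univ_of_forall fun v => Subsingleton.elim _ _
      have h1 : trunc X 1 ⁻¹' {w} = {y | y 0 = w 0} := by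
        ext y
        simp [trunc, funext_iff]
      rw [h0, h1, probReal_univ, processLaw_eval_zero]
      simp
    | succ n =>
      set u : Finset.Iic n → X := fun k => w ⟨k, by have := Finset.mem_Iic.1 k.2; omega⟩ with hu
      have hset : trunc X (n + 1 + 1) ⁻¹' {w} =
          (fun x : ℕ → X => (Preorder.frestrictLe (π := fun _ : ℕ => X) n x, x (n + 1))) ⁻¹'
            ({u} ×ˢ {w (Fin.last _)}) := by
        ext x
        simp only [Set.mem_preimage, Set.mem_singleton_iff, Set.mem_prod, funext_iff, trunc,
          Subtype.forall, hu]
        rw [Fin.forall_fin_succ']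
        refine and_congr ⟨fun h a ha => h ⟨a, by have := Finset.mem_Iic.1 ha; omega⟩,
          fun h k => h k (Finset.mem_Iic.2 (by omega))⟩ Iff.rfl
      have hset' : trunc X (n + 1) ⁻¹' {fun k : Fin (n + 1) => w k.castSucc} =
          Preorder.frestrictLe (π := fun _ : ℕ => X) n ⁻¹' {u} := by
        ext x
        simp only [Set.mem_preimage, Set.mem_singleton_iff, funext_iff, trunc, Subtype.forall, hu]
        exact ⟨fun h a ha => h ⟨a, by have := Finset.mem_Iic.1 ha; omega⟩,
          fun h k => h k (Finset.mem_Iic.2 (by omega))⟩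
      rw [hset, hset', measureReal_def, measureReal_def, ← Measure.map_apply (by fun_prop)
        ((measurableSet_singleton _).prod (measurableSet_singleton _)), processLaw,
        ← Kernel.map_frestrictLe_trajMeasure_compProd_eq_map_trajMeasure,
        Measure.compProd_apply_prod (measurableSet_singleton _) (measurableSet_singleton _),
        lintegral_singleton, ENNReal.toReal_mul, mul_comm,
        Measure.map_apply (by fun_prop) (measurableSet_singleton _)]
      congr 2
      exact PMF.toMeasure_apply_singleton _ _ (measurableSet_singleton _)

theorem processLaw_map_comp_map_trunc {Y : Type*} [MeasurableSpace Y] [Finite Y]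
    [MeasurableSingletonClass Y] (φ : X → Y) (n : ℕ) (w : Fin n → Y) :
    (((processLaw next).map fun x t => φ (x t)).map (trunc Y n)).real {w} =
      obsProb next φ [] (List.ofFn w) := by
  classical
  have hφ : Measurable φ := measurable_of_finite φ
  have hcomp : (trunc Y n ∘ fun (x : ℕ → X) t => φ (x t)) = (φ ∘ ·) ∘ trunc X n := rfl
  rw [Measure.map_map (measurable_trunc n) (by fun_prop), hcomp,
    ← Measure.map_map (measurable_of_finite _) (measurable_trunc n),
    map_measureReal_apply (measurable_of_finite _) (measurableSet_singleton _), obsProb_eq_sum]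
  have hset : (φ ∘ · : (Fin n → X) → _) ⁻¹' {w} =
      (Finset.univ.filter fun v : Fin n → X => φ ∘ v = w : Finset (Fin n → X)) := by
    ext v
    simp
  rw [hset, ← sum_measureReal_singleton, Finset.sum_filter]
  simp only [processLaw_map_trunc]

end Trunc

theorem piPMF_apply {ι : Type*} [Fintype ι] {X : ι → Type*} [∀ i, Fintype (X i)]
    (p : ∀ i, PMF (X i)) (y : ∀ i, X i) : piPMF p y = ∏ i, p i (y i) := rfl

/-! ### From beliefs to true paths -/

section Beliefs

variable {ι X : Type*} [Fintype ι] [DecidableEq ι] [Fintype X] {Y : ι → Type*}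
  {proj : ∀ i, X → Y i} {next : List X → PMF X} {f : List X → Bool} {actual : (ι → X) → X}
  {nextB : List (ι → X) → PMF (ι → X)}

/-- The true letter is `x` iff every agent's own component of its version agrees with `x`, so the
sum over belief tuples factors over the agents. A prefix witnessing the loss stays a prefix, so the
factorisation persists. -/
theorem obsProb_of_lost (hinj : Function.Injective fun x i => proj i x)
    (hact : ∀ c i, proj i (actual c) = proj i (c i))
    (hlost : ∀ h, (∃ u, u <+: h.map actual ∧ f u ≠ true) →
      nextB h = piPMF fun i => next (h.map fun c => c i))
    {h : List (ι → X)} (hh : ∃ u, u <+: h.map actual ∧ f u ≠ true) (w : List X) :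
    obsProb nextB actual h w =
      ∏ i, obsProb next (proj i) (h.map fun c => c i) (w.map (proj i)) := by
  classical
  induction w generalizing h with
  | nil => simp [obsProb]
  | cons x w ih =>
    simp only [List.map_cons, obsProb]
    rw [Fintype.prod_sum]
    refine Fintype.sum_congr _ _ fun c => ?_
    have hiff : actual c = x ↔ ∀ i, proj i (c i) = proj i x := by
      refine ⟨fun hc i => by rw [← hc, hact], fun hc => hinj ?_⟩
      funext i
      exact (hact c i).trans (hc i)
    split_ifs with hc
    · have hh' : ∃ u, u <+: (h ++ [c]).map actual ∧ f u ≠ true := by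
        obtain ⟨u, hu, hfu⟩ := hh
        exact ⟨u, by rw [List.map_append]; exact hu.trans (List.prefix_append _ _), hfu⟩
      rw [hlost h hh, ih hh', piPMF_apply, ENNReal.toReal_prod, ← Finset.prod_mul_distrib]
      refine Finset.prod_congr rfl fun i _ => ?_
      rw [if_pos (hiff.1 hc i), List.map_append, List.map_singleton]
    · obtain ⟨i, hi⟩ := not_forall.1 (mt hiff.2 hc)
      exact (Finset.prod_eq_zero (Finset.mem_univ i) (if_neg hi)).symm

/-- While connected, all agents hold the same version, so the history of beliefs is determined by
the true one. Only proper prefixes are assumed available: `f h` decides how the next letter is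
drawn. -/
theorem obsProb_of_connected (hinj : Function.Injective fun x i => proj i x)
    (hact : ∀ c i, proj i (actual c) = proj i (c i))
    (hconn : ∀ h, (∀ u, u <+: h → f u = true) →
      nextB (h.map fun x _ => x) = (next h).map fun x _ => x)
    (hlost : ∀ h, (∃ u, u <+: h.map actual ∧ f u ≠ true) →
      nextB h = piPMF fun i => next (h.map fun c => c i))
    {h : List X} (hh : ∀ u, u <+: h → u ≠ h → f u = true) (w : List X) :
    obsProb nextB actual (h.map fun x _ => x) w = imagProb proj next f h w := by
  classical
  have hconst : ∀ x, actual (fun _ => x) = x := fun x => hinj (funext fun i => hact _ i)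
  induction w generalizing h with
  | nil => rfl
  | cons x w ih =>
    by_cases hf : f h = true
    · have hall : ∀ u, u <+: h → f u = true := fun u hu => by
        rcases eq_or_ne u h with rfl | hne
        exacts [hf, hh u hu hne]
      have hh' : ∀ u, u <+: h ++ [x] → u ≠ h ++ [x] → f u = true := fun u hu hne =>
        hall u ((List.prefix_concat_iff.1 hu).resolve_left hne)
      have hih := ih hh'
      rw [List.map_append, List.map_singleton] at hih
      rw [imagProb, if_pos hf, ← hih, obsProb, hconn h hall]
      -- Among the belief tuples showing `x`, only the constant one has positive probability.
      have hmap : ∀ c : ι → X, (if actual c = x then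
          (((next h).map fun x (_ : ι) => x) c).toReal *
            obsProb nextB actual ((h.map fun x _ => x) ++ [c]) w else 0) =
          if c = fun _ => x then (next h x).toReal *
            obsProb nextB actual ((h.map fun x _ => x) ++ [fun _ => x]) w else 0 := by
        intro c
        by_cases hc : c = fun _ => x
        · subst hc
          rw [if_pos (hconst x), if_pos rfl]
          congr 2
          rw [PMF.map_apply]
          refine (tsum_eq_single x fun x' hx' => if_neg fun h' => hx' ?_).trans (if_pos rfl)
          rw [← hconst x', ← h', hconst]
        · rw [if_neg hc]
          split_ifs with hcx
          · rw [PMF.map_apply, ENNReal.tsum_eq_zero.2, ENNReal.toReal_zero, zero_mul]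
            intro x'
            refine if_neg fun h' => hc ?_
            rw [h', hconst] at hcx
            rw [h', hcx]
          · rfl
      refine (Fintype.sum_congr _ _ hmap).trans ?_
      simp
    · rw [imagProb, if_neg hf, obsProb_of_lost hinj hact hlost]
      · simp [Function.comp_def]
      · refine ⟨h, ?_, hf⟩
        simp [Function.comp_def, hconst]

end Beliefs

theorem imagProb_false {ι X : Type*} [Fintype ι] [Fintype X] {Y : ι → Type*}
    (proj : ∀ i, X → Y i) (next : List X → PMF X) (h w : List X) :
    imagProb proj next (fun _ => false) h w =
      ∏ i, obsProb next (proj i) h (w.map (proj i)) := by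
  cases w with
  | nil => simp [imagProb, obsProb]
  | cons x w => simp [imagProb]

/-! ### Entropy of discrete laws -/

theorem ae_singleton_ne_zero {Z : Type*} [MeasurableSpace Z] {μ : Measure Z}
    [IsFiniteMeasure μ] {s : Set Z} (hs : s.Countable) (hμ : μ sᶜ = 0) : ∀ᵐ z ∂μ, μ.real {z} ≠ 0 := by
  have hnull : μ {z | z ∈ s ∧ μ {z} = 0} = 0 := by
    rw [← Set.biUnion_of_singleton {z | z ∈ s ∧ μ {z} = 0},
      measure_biUnion_null_iff (hs.mono fun _ h => h.1)]
    exact fun z hz => hz.2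
  filter_upwards [measure_eq_zero_iff_ae_notMem.1 hμ, measure_eq_zero_iff_ae_notMem.1 hnull]
    with z h1 h2 h0
  exact h2 ⟨not_not.1 h1, (measureReal_eq_zero_iff).1 h0⟩

theorem exists_carrier_of_entropy_ne_top {Z : Type*} [MeasurableSpace Z]
    {μ : Measure Z} (h : entropy μ ≠ ⊤) :
    ∃ s : Set Z, s.Countable ∧ μ sᶜ = 0 := by
  by_contra hs
  exact h (if_neg hs)

section Entropy

variable {Z : Type*} [MeasurableSpace Z] [MeasurableSingletonClass Z]

theorem aemeasurable_of_countable_carrier {E : Type*} [MeasurableSpace E] [Zero E] {μ : Measure Z}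
    {s : Set Z} (hs : s.Countable) (hμ : μ sᶜ = 0) (f : Z → E) : AEMeasurable f μ := by
  refine ⟨s.indicator f, ?_, ?_⟩
  · refine (measurable_const (a := (0 : E))).measurable_of_countable_ne (hs.mono fun x hx => ?_)
    by_contra hxs
    exact hx (Set.indicator_of_notMem hxs f).symm
  · filter_upwards [measure_eq_zero_iff_ae_notMem.1 hμ] with x hx
    exact (Set.indicator_of_mem (not_not.1 hx) f).symm

/-- As an expectation of `-log` of atom masses, a marginal entropy can be pulled back to an integral
against the joint law. -/
theorem entropy_eq_lintegral {μ : Measure Z}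
    [IsFiniteMeasure μ] {s : Set Z} (hs : s.Countable) (hμ : μ sᶜ = 0) : entropy μ = ∫⁻ z, ENNReal.ofReal (-Real.log (μ.real {z})) ∂μ := by
  have hres : μ.restrict s = μ := Measure.restrict_eq_self_of_ae_mem (by
    filter_upwards [measure_eq_zero_iff_ae_notMem.1 hμ] with z hz using not_not.1 hz)
  have hterm : ∀ z, ENNReal.ofReal (Real.negMulLog (μ.real {z})) =
      ENNReal.ofReal (-Real.log (μ.real {z})) * μ {z} := fun z => by
    rw [← ofReal_measureReal (μ := μ) (s := {z}), ← ENNReal.ofReal_mul' measureReal_nonneg,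
      Real.negMulLog, neg_mul_comm, mul_comm]
  rw [entropy, if_pos ⟨s, hs, hμ⟩]
  refine Eq.trans ?_ ((lintegral_countable _ hs).symm.trans (by rw [hres]))
  simp only [hterm]
  refine (tsum_subtype_eq_of_support_subset fun z hz => ?_).symm
  by_contra hzs
  exact hz (mul_eq_zero_of_right _ (measure_mono_null (Set.singleton_subset_iff.2 hzs) hμ))

/-- The divergence from a discrete law of finite entropy to a law whose atoms have the product of
the probabilities of the atoms of the marginal laws is the excess of the sum of the marginal
entropies over the joint entropy. -/
theorem klDiv_eq_sum_entropy_sub_entropy {ι : Type*} [Fintype ι] {W : ι → Type*}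
    [∀ i, MeasurableSpace (W i)] [∀ i, MeasurableSingletonClass (W i)] {P R : Measure Z}
    [IsProbabilityMeasure P] [IsProbabilityMeasure R] {φ : ∀ i, Z → W i}
    (hφ : ∀ i, Measurable (φ i)) (hR : ∀ z, R.real {z} = ∏ i, (P.map (φ i)).real {φ i z})
    (hP : entropy P ≠ ⊤) :
    (klDiv P R : EReal) =
      ((∑ i, entropy (P.map (φ i)) : ℝ≥0∞) : EReal) - (entropy P : EReal) := by
  obtain ⟨s, hs, hsP⟩ := exists_carrier_of_entropy_ne_top hP
  have hPi : ∀ i, IsProbabilityMeasure (P.map (φ i)) := fun i =>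
    Measure.isProbabilityMeasure_map (hφ i).aemeasurable
  have hsi : ∀ i, (P.map (φ i)) (φ i '' s)ᶜ = 0 := fun i => by
    rw [Measure.map_apply (hφ i) (hs.image _).measurableSet.compl]
    exact measure_mono_null (fun z hz hzs => hz (Set.mem_image_of_mem _ hzs)) hsP
  have hne := ae_singleton_ne_zero hs hsP
  -- Marginal atoms are heavier, so the integrable joint `-log` dominates the marginal ones; finite
  -- joint entropy thus forces finite marginal entropies.
  have hle : ∀ i z, P.real {z} ≤ (P.map (φ i)).real {φ i z} := fun i z => by
    rw [map_measureReal_apply (hφ i) (measurableSet_singleton _)]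
    exact measureReal_mono (by simp)
  have hae : ∀ f : Z → ℝ, AEStronglyMeasurable f P := fun f =>
    (aemeasurable_of_countable_carrier hs hsP f).aestronglyMeasurable
  have hneg : ∀ {p : ℝ}, 0 ≤ p → p ≤ 1 → 0 ≤ -Real.log p := fun h0 h1 =>
    neg_nonneg.2 (Real.log_nonpos h0 h1)
  have hP0 : ∀ z, 0 ≤ -Real.log (P.real {z}) := fun z => hneg measureReal_nonneg measureReal_le_one
  have hPi0 : ∀ i z, 0 ≤ -Real.log ((P.map (φ i)).real {φ i z}) := fun i z =>
    hneg measureReal_nonneg measureReal_le_one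
  have hint : Integrable (fun z => -Real.log (P.real {z})) P := by
    refine (lintegral_ofReal_ne_top_iff_integrable (hae _) (ae_of_all _ hP0)).1 ?_
    rwa [← entropy_eq_lintegral hs hsP]
  have hinti : ∀ i, Integrable (fun z => -Real.log ((P.map (φ i)).real {φ i z})) P := fun i => by
    refine hint.mono (hae _) ?_
    filter_upwards [hne] with z hz
    rw [Real.norm_of_nonneg (hPi0 i z), Real.norm_of_nonneg (hP0 z)]
    exact neg_le_neg (Real.log_le_log (measureReal_nonneg.lt_of_ne' hz) (hle i z))
  have hE : entropy P = ENNReal.ofReal (∫ z, -Real.log (P.real {z}) ∂P) := by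
    rw [entropy_eq_lintegral hs hsP, ofReal_integral_eq_lintegral_ofReal hint (ae_of_all _ hP0)]
  have hEi : ∀ i, entropy (P.map (φ i)) =
      ENNReal.ofReal (∫ z, -Real.log ((P.map (φ i)).real {φ i z}) ∂P) := fun i => by
    rw [entropy_eq_lintegral (hs.image _) (hsi i), lintegral_map'
      (aemeasurable_of_countable_carrier (hs.image _) (hsi i) _) (hφ i).aemeasurable,
      ofReal_integral_eq_lintegral_ofReal (hinti i) (ae_of_all _ (hPi0 i))]
  have hRpos : ∀ z, P.real {z} ≠ 0 → 0 < R.real {z} := fun z hz => by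
    rw [hR]
    exact Finset.prod_pos fun i _ => (measureReal_nonneg.lt_of_ne' hz).trans_le (hle i z)
  have hac : P ≪ R := fun t ht => by
    refine measure_eq_zero_iff_ae_notMem.2 ?_
    filter_upwards [hne] with z hz hzt
    refine (hRpos z hz).ne' ?_
    rw [measureReal_def, measure_mono_null (Set.singleton_subset_iff.2 hzt) ht, ENNReal.toReal_zero]
  have hllr : llr P R =ᵐ[P] fun z =>
      ∑ i, -Real.log ((P.map (φ i)).real {φ i z}) - -Real.log (P.real {z}) := by
    filter_upwards [hne] with z hz
    rw [llr_of_singleton_ne_zero hac hz, hR, Real.log_prod fun i _ =>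
      ((measureReal_nonneg.lt_of_ne' hz).trans_le (hle i z)).ne', Finset.sum_neg_distrib]
    ring
  have hsum : Integrable (fun z => ∑ i, -Real.log ((P.map (φ i)).real {φ i z})) P :=
    integrable_finsetSum _ fun i _ => hinti i
  have hllrint : Integrable (llr P R) P := (integrable_congr hllr).2 (hsum.sub hint)
  have hval : ∫ z, llr P R z ∂P = ∑ i, ∫ z, -Real.log ((P.map (φ i)).real {φ i z}) ∂P -
      ∫ z, -Real.log (P.real {z}) ∂P := by
    rw [integral_congr_ae hllr, integral_sub hsum hint, integral_finsetSum _ fun i _ => hinti i]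
  have hnonneg := integral_llr_add_sub_measure_univ_nonneg hac hllrint
  rw [klDiv_of_ac_of_integrable hac hllrint, hE]
  simp only [hEi, probReal_univ, add_sub_cancel_right] at hnonneg ⊢
  -- All terms are finite and nonnegative, so the `EReal` subtraction is a real one.
  rw [← ENNReal.ofReal_sum_of_nonneg fun i _ => integral_nonneg (hPi0 i),
    EReal.coe_ennreal_ofReal, EReal.coe_ennreal_ofReal, EReal.coe_ennreal_ofReal,
    max_eq_left hnonneg, max_eq_left (integral_nonneg hP0),
    max_eq_left (Finset.sum_nonneg fun i _ => integral_nonneg (hPi0 i)), hval, EReal.coe_sub]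

end Entropy

/-! ### The laws of the game -/

/-- The local state and the local action of agent `i`. -/
def agentProj {ι : Type*} {S A : ι → Type*} (i : ι) (x : Joint S A) : S i × A i := (x.1 i, x.2 i)

theorem agentProj_injective {ι : Type*} {S A : ι → Type*} :
    Function.Injective fun (x : Joint S A) i => agentProj i x :=
  fun _ _ h => Prod.ext (funext fun i => congrArg Prod.fst (congrFun h i))
    (funext fun i => congrArg Prod.snd (congrFun h i))

/-- The joint path that consists of the given paths of the single agents. -/
def jointPath {ι : Type*} {S A : ι → Type*} (y : ∀ i, ℕ → S i × A i) (t : ℕ) : Joint S A :=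
  (fun i => (y i t).1, fun i => (y i t).2)

theorem measurable_jointPath {ι : Type*} {S A : ι → Type*} [∀ i, MeasurableSpace (S i)]
    [∀ i, MeasurableSpace (A i)] : Measurable (jointPath (S := S) (A := A)) := by
  unfold jointPath
  fun_prop

section Laws

variable {ι : Type*} [Fintype ι] {S A : ι → Type*}
  [∀ i, Fintype (S i)] [∀ i, Fintype (A i)]

/-- The law of the next joint letter under full communication, given the joint history. -/
def Game.nextFull (G : Game ι S A) (π : Policy S A) (h : List (Joint S A)) : PMF (Joint S A) :=
  G.nextJoint π h.getLast?

theorem Game.nextImaginary_of_connected (G : Game ι S A) (π : Policy S A)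
    (f : List (Joint S A) → Bool) (h : List (Joint S A)) (hh : ∀ u, u <+: h → f u = true) :
    G.nextImaginary π f (h.map fun x _ => x) = (G.nextFull π h).map fun x _ => x := by
  have hmap : (h.map fun x (_ : ι) => x).map Beliefs.actual = h := by
    simp [Function.comp_def, Beliefs.actual]
  have hc : Connected f h := hh
  rw [Game.nextImaginary, hmap, if_pos hc]
  rfl

theorem Game.nextImaginary_of_lost [DecidableEq ι] (G : Game ι S A) (π : Policy S A)
    (f : List (Joint S A) → Bool) (h : List (Beliefs S A))
    (hh : ∃ u, u <+: h.map Beliefs.actual ∧ f u ≠ true) :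
    G.nextImaginary π f h =
      piPMF (X := fun _ : ι => Joint S A) fun i => G.nextFull π (h.map fun c => c i) := by
  obtain ⟨u, hu, hfu⟩ := hh
  have hc : ¬ Connected f (h.map Beliefs.actual) := fun hc => hfu (hc u hu)
  rw [Game.nextImaginary, if_neg hc]
  simp only [Game.nextFull, List.getLast?_map]
  congr!

variable [∀ i, MeasurableSpace (S i)] [∀ i, MeasurableSingletonClass (S i)]
  [∀ i, MeasurableSpace (A i)] [∀ i, MeasurableSingletonClass (A i)]
  (G : Game ι S A) (π : Policy S A) (f : List (Joint S A) → Bool)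

instance isProbabilityMeasure_fullLaw : IsProbabilityMeasure (G.fullLaw π) :=
  isProbabilityMeasure_processLaw _

instance isProbabilityMeasure_imaginaryLaw : IsProbabilityMeasure (G.imaginaryLaw π f) :=
  have := isProbabilityMeasure_processLaw (G.nextImaginary π f)
  Measure.isProbabilityMeasure_map (measurable_pi_lambda _ fun t =>
    (measurable_of_finite Beliefs.actual).comp (measurable_pi_apply t)).aemeasurable

theorem measurable_agentPath (i : ι) :
    Measurable fun (x : ℕ → Joint S A) t => agentProj i (x t) :=
  measurable_pi_lambda _ fun t => (measurable_of_finite (agentProj i)).comp (measurable_pi_apply t)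

instance isProbabilityMeasure_agentLaw (i : ι) : IsProbabilityMeasure (G.agentLaw π i) :=
  Measure.isProbabilityMeasure_map (measurable_agentPath i).aemeasurable

section

variable [DecidableEq ι]

theorem fullLaw_map_trunc (n : ℕ) (w : Fin n → Joint S A) :
    ((G.fullLaw π).map (trunc _ n)).real {w} = obsProb (G.nextFull π) id [] (List.ofFn w) :=
  processLaw_map_trunc (G.nextFull π) n w

theorem agentLaw_map_trunc (i : ι) (n : ℕ) (w : Fin n → S i × A i) :
    ((G.agentLaw π i).map (trunc _ n)).real {w} =
      obsProb (G.nextFull π) (agentProj i) [] (List.ofFn w) :=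
  processLaw_map_comp_map_trunc (G.nextFull π) (agentProj i) n w

theorem imaginaryLaw_map_trunc (n : ℕ) (w : Fin n → Joint S A) :
    ((G.imaginaryLaw π f).map (trunc _ n)).real {w} =
      imagProb agentProj (G.nextFull π) f [] (List.ofFn w) :=
  (processLaw_map_comp_map_trunc (G.nextImaginary π f) Beliefs.actual n w).trans
    (obsProb_of_connected (h := []) agentProj_injective (fun _ _ => rfl)
      (G.nextImaginary_of_connected π f) (G.nextImaginary_of_lost π f)
      (fun _ hu hne => absurd (List.prefix_nil.1 hu) hne) _)

end

theorem pi_agentLaw_map_trunc [DecidableEq ι] (n : ℕ) (w : Fin n → Joint S A) :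
    (((Measure.pi (G.agentLaw π)).map jointPath).map (trunc _ n)).real {w} =
      ∏ i, obsProb (G.nextFull π) (agentProj i) [] ((List.ofFn w).map (agentProj i)) := by
  have hset : jointPath ⁻¹' (trunc (Joint S A) n ⁻¹' {w}) = Set.univ.pi fun i =>
      trunc (S i × A i) n ⁻¹' {agentProj i ∘ w} := by
    ext y
    simp only [Set.mem_preimage, Set.mem_singleton_iff, Set.mem_pi, Set.mem_univ, true_imp_iff]
    refine ⟨fun h i => ?_, fun h => funext fun k => agentProj_injective (funext fun i => ?_)⟩
    · rw [← h]; rfl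
    · exact congrFun (h i) k
  rw [map_measureReal_apply (measurable_trunc _) (measurableSet_singleton _),
    map_measureReal_apply measurable_jointPath (measurable_trunc _ (measurableSet_singleton _)),
    hset, measureReal_def, Measure.pi_pi, ENNReal.toReal_prod]
  refine Finset.prod_congr rfl fun i _ => ?_
  rw [← measureReal_def, ← map_measureReal_apply (measurable_trunc _) (measurableSet_singleton _),
    agentLaw_map_trunc, List.map_ofFn]

instance isProbabilityMeasure_pi_agentLaw :
    IsProbabilityMeasure ((Measure.pi (G.agentLaw π)).map jointPath) :=
  Measure.isProbabilityMeasure_map measurable_jointPath.aemeasurable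

/-- With the loss at time `0`, each agent plays its own independent copy of the full process and
shows only its own component; word probabilities determine the law. -/
theorem imaginaryLawZero_eq :
    G.imaginaryLawZero π = (Measure.pi (G.agentLaw π)).map jointPath := by
  classical
  have : IsProbabilityMeasure (G.imaginaryLawZero π) := isProbabilityMeasure_imaginaryLaw G π _
  refine ext_of_map_trunc fun n w => ?_
  rw [pi_agentLaw_map_trunc, Game.imaginaryLawZero, imaginaryLaw_map_trunc, imagProb_false]

/-- The entropy term is common to both divergences. The cross terms are compared with `R i` taken as
the law of agent `i`'s words from the empty history. -/
theorem klDiv_imaginaryLaw_map_trunc_le (n : ℕ) :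
    klDiv ((G.fullLaw π).map (trunc _ n)) ((G.imaginaryLaw π f).map (trunc _ n)) ≤
      klDiv ((G.fullLaw π).map (trunc _ n)) ((G.imaginaryLawZero π).map (trunc _ n)) := by
  classical
  have hprob : ∀ μ : Measure (ℕ → Joint S A), IsProbabilityMeasure μ →
      IsProbabilityMeasure (μ.map (trunc _ n)) := fun μ _ =>
    Measure.isProbabilityMeasure_map (measurable_trunc n).aemeasurable
  have := hprob (G.fullLaw π) inferInstance
  have := fun f => hprob (G.imaginaryLaw π f) inferInstance
  have hpos : ∀ (f : List (Joint S A) → Bool) (w : Fin n → Joint S A),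
      0 < ((G.fullLaw π).map (trunc _ n)).real {w} →
      0 < ((G.imaginaryLaw π f).map (trunc _ n)).real {w} := fun f w hw => by
    rw [fullLaw_map_trunc] at hw
    rw [imaginaryLaw_map_trunc]
    exact imagProb_pos _ _ _ hw
  rw [Game.imaginaryLawZero, klDiv_of_finite (hpos f), klDiv_of_finite (hpos _)]
  simp only [fullLaw_map_trunc, imaginaryLaw_map_trunc, imagProb_false]
  refine ENNReal.ofReal_le_ofReal (sub_le_sub_left ?_ _)
  exact sum_mul_log_prod_le_imagProb agentProj (G.nextFull π) f agentProj_injective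
    (R := fun i => obsProb (G.nextFull π) (agentProj i) [])
    (fun i _ => obsProb_nonneg _ _ _ _) (fun i => (sum_obsProb _ _ _ _).le)
    (fun w hw i => obsProb_map_pos _ _ hw)

theorem klDiv_imaginaryLaw_le :
    klDiv (G.fullLaw π) (G.imaginaryLaw π f) ≤ klDiv (G.fullLaw π) (G.imaginaryLawZero π) := by
  have : IsProbabilityMeasure (G.imaginaryLawZero π) := isProbabilityMeasure_imaginaryLaw G π _
  -- The data-processing inequality `klDiv_map_le` bounds each finite-horizon divergence without
  -- communication by that of the infinite paths.
  exact klDiv_le_of_forall_klDiv_map_le (truncFiltration _) (fun _ => rfl) iSup_truncFiltration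
    fun n => (klDiv_imaginaryLaw_map_trunc_le G π f n).trans (klDiv_map_le _ _ (measurable_trunc n))

theorem pi_agentLaw_map_jointPath_singleton (x : ℕ → Joint S A) :
    ((Measure.pi (G.agentLaw π)).map jointPath).real {x} =
      ∏ i, (G.agentLaw π i).real {fun t => agentProj i (x t)} := by
  have hset : jointPath ⁻¹' {x} = Set.univ.pi fun i => {fun t => agentProj i (x t)} := by
    ext y
    simp only [Set.mem_preimage, Set.mem_singleton_iff, Set.mem_pi, Set.mem_univ, true_imp_iff]
    refine ⟨fun h i => ?_, fun h => funext fun k => agentProj_injective (funext fun i => ?_)⟩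
    · rw [← h]; rfl
    · exact congrFun (h i) k
  rw [map_measureReal_apply measurable_jointPath (measurableSet_singleton _), hset,
    measureReal_def, Measure.pi_pi, ENNReal.toReal_prod]
  rfl

end Laws

end

end ImaginaryPlay

theorem mainTheorem4 {ι : Type*} [Fintype ι] {S A : ι → Type*}
    [∀ i, Fintype (S i)] [∀ i, Fintype (A i)]
    [∀ i, MeasurableSpace (S i)] [∀ i, MeasurableSingletonClass (S i)]
    [∀ i, MeasurableSpace (A i)] [∀ i, MeasurableSingletonClass (A i)]
    (G : ImaginaryPlay.Game ι S A) (π : ImaginaryPlay.Policy S A)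
    (f : List (ImaginaryPlay.Joint S A) → Bool) :
    klDiv (G.fullLaw π) (G.imaginaryLaw π f) ≤ klDiv (G.fullLaw π) (G.imaginaryLawZero π) ∧
    klDiv (G.fullLaw π) (G.imaginaryLawZero π) = G.totalCorrelation π ∧
    (ImaginaryPlay.entropy (G.fullLaw π) ≠ ⊤ →
      (G.totalCorrelation π : EReal) =
        ((∑ i, ImaginaryPlay.entropy (G.agentLaw π i) : ℝ≥0∞) : EReal) -
          (ImaginaryPlay.entropy (G.fullLaw π) : EReal)) := by
  refine ⟨ImaginaryPlay.klDiv_imaginaryLaw_le G π f, ?_, fun h => ?_⟩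
  · rw [ImaginaryPlay.imaginaryLawZero_eq]
    rfl
  · have := ImaginaryPlay.isProbabilityMeasure_pi_agentLaw G π
    exact ImaginaryPlay.klDiv_eq_sum_entropy_sub_entropy (R := (Measure.pi (G.agentLaw π)).map
      ImaginaryPlay.jointPath)
      (fun i => ImaginaryPlay.measurable_agentPath i)
      (ImaginaryPlay.pi_agentLaw_map_jointPath_singleton G π) h
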